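/- Let $n\ge 0$ and let $\mathfrak S_n$ be the set of permutations of $\{1,\dots,n\}$. For $\sigma\in\mathfrak S_n$ let $\operatorname{depth}(\sigma)=\sum_{\sigma(i)>i}(\sigma(i)-i)$, let $\ell_S(\sigma)$ (length) be the least number of factors in an expression of $\sigma$ as a product of adjacent transpositions $(i\ \,i{+}1)$, and let $\ell_T(\sigma)$ (reflection length) be the least number of factors in an expression of $\sigma$ as a product of conjugates of adjacent transpositions. Call $\sigma$ \emph{shallow} if $\operatorname{depth}(\sigma)=\frac{\ell_S(\sigma)+\ell_T(\sigma)}{2}$, and an \emph{involution} if $\sigma^2=1$ (the identity is included). Let $\Phi(\sigma)\in\mathfrak S_n$ be the image of $\sigma$ under the fundamental bijection: write each cycle $(m\ \,\sigma(m)\ \,\sigma^2(m)\cdots)$ of $\sigma$, fixed points included, starting from its largest element $m$, order the cycles from left to right by increasing largest element, and erase the parentheses; the resulting word is the one-line notation of $\Phi(\sigma)$. A permutation $\tau=\tau_1\cdots\tau_n$ \emph{contains} the vincular pattern $\underline{31}\,\underline{42}$ (underlined symbols must be adjacent) if there are positions $i$ and $j$ with $i+1<j<j+1\le n$ such that $\tau_{i+1}<\tau_{j+1}<\tau_i<\tau_j$;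 otherwise it \emph{avoids} this pattern. Let $M_n$ be the $n$-th Motzkin number: $M_0=1$ and $M_{n+1}=M_n+\sum_{i=0}^{n-1}M_iM_{n-1-i}$. Then: 1. An involution $\sigma\in\mathfrak S_n$ is shallow if and only if $\Phi(\sigma)$ avoids $\underline{31}\,\underline{42}$. 2. Place points $1,\dots,n$ in order around a circle. Sending an involution $\sigma$ to the set of chords joining distinct points in the same cycle of $\sigma$ is a bijection from the shallow involutions in $\mathfrak S_n$ to the noncrossing partial chord diagrams on $n$ points, that is, the sets of chords, no two sharing an endpoint, that contain no two chords $\{a,c\},\{b,d\}$ with $a<b<c<d$. 3. The number of shallow involutions in $\mathfrak S_n$ and the number of noncrossing partial chord diagrams on $n$ points are both equal to $M_n$. -/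

import Mathlib

namespace ShallowPerm

open Equiv

/-! ### Depth, length, reflection length, shallow permutations -/

/-- The depth of a permutation: the sum of `σ i - i` over all `i` with `i < σ i`. -/
def depth {n : ℕ} (σ : Perm (Fin n)) : ℕ :=
  ∑ i : Fin n with i < σ i, ((σ i : ℕ) - (i : ℕ))

/-- The simple reflections: the transpositions of two adjacent letters `i`, `i + 1`. -/
def simpleReflections (n : ℕ) : Set (Perm (Fin n)) :=
  {s | ∃ i j : Fin n, (j : ℕ) = i + 1 ∧ s = swap i j}

/-- The reflections: all conjugates of the simple reflections. -/
def reflections (n : ℕ) : Set (Perm (Fin n)) :=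
  {t | ∃ g : Perm (Fin n), ∃ s ∈ simpleReflections n, t = g * s * g⁻¹}

/-- The least `k` such that `σ` is a product of `k` elements of `A`. -/
noncomputable def wordLength {n : ℕ} (A : Set (Perm (Fin n))) (σ : Perm (Fin n)) : ℕ :=
  sInf {k : ℕ | ∃ l : List (Perm (Fin n)), (∀ a ∈ l, a ∈ A) ∧ l.prod = σ ∧ l.length = k}

/-- The (Coxeter) length of a permutation. -/
noncomputable def length {n : ℕ} (σ : Perm (Fin n)) : ℕ := wordLength (simpleReflections n) σ

/-- The reflection length of a permutation. -/
noncomputable def reflectionLength {n : ℕ} (σ : Perm (Fin n)) : ℕ :=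
  wordLength (reflections n) σ

/-- A permutation is shallow if its depth is the mean of its length and reflection length. -/
def IsShallow {n : ℕ} (σ : Perm (Fin n)) : Prop :=
  (depth σ : ℚ) = ((length σ : ℚ) + (reflectionLength σ : ℚ)) / 2

/-! Every permutation is a product of simple reflections (hence of reflections), so the
infimum defining the two lengths is a minimum over a nonempty set. -/

theorem exists_simpleReflections_word {n : ℕ} (σ : Perm (Fin n)) :
    ∃ l : List (Perm (Fin n)), (∀ a ∈ l, a ∈ simpleReflections n) ∧ l.prod = σ := by
  cases n with
  | zero => exact ⟨[], by simp, Subsingleton.elim _ _⟩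
  | succ n =>
    have h : σ ∈ Submonoid.closure (Set.range fun i : Fin n => swap i.castSucc i.succ) := by
      rw [Equiv.Perm.mclosure_swap_castSucc_succ]; trivial
    obtain ⟨l, hl, hp⟩ := Submonoid.exists_list_of_mem_closure h
    refine ⟨l, fun a ha => ?_, hp⟩
    obtain ⟨i, rfl⟩ := hl a ha
    exact ⟨i.castSucc, i.succ, by simp, rfl⟩

theorem simpleReflections_subset_reflections (n : ℕ) :
    simpleReflections n ⊆ reflections n := fun s hs => ⟨1, s, hs, by simp⟩

/-! ### The fundamental bijection -/

/-- The largest elements of the cycles of `σ` (fixed points included), in increasing order. -/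
def cycleMaxima {n : ℕ} (σ : Perm (Fin n)) : List (Fin n) :=
  (List.finRange n).filter fun m => ∀ x : Fin n, σ.SameCycle m x → x ≤ m

/-- The cycle of `σ` through `m`, written starting from `m`: `[m, σ m, σ (σ m), …]`. -/
noncomputable def cycleFrom {n : ℕ} (σ : Perm (Fin n)) (m : Fin n) : List (Fin n) :=
  List.iterate σ m (Function.minimalPeriod σ m)

/-- The standard representation of the cycle notation of `σ` (each cycle starts with its largest
element, cycles are ordered by increasing largest element), with the parentheses erased. -/
noncomputable def fundamentalWord {n : ℕ} (σ : Perm (Fin n)) : List (Fin n) :=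
  (cycleMaxima σ).flatMap (cycleFrom σ)

theorem mem_cycleFrom {n : ℕ} (σ : Perm (Fin n)) (m x : Fin n) :
    x ∈ cycleFrom σ m ↔ σ.SameCycle m x := by
  have hpos : 0 < Function.minimalPeriod σ m :=
    Function.minimalPeriod_pos_of_mem_periodicPts
      (Function.Injective.mem_periodicPts σ.injective m)
  rw [cycleFrom, List.mem_iterate]
  constructor
  · rintro ⟨k, -, rfl⟩
    exact ⟨k, by simp [Equiv.Perm.iterate_eq_pow]⟩
  · intro h
    obtain ⟨k, -, hk⟩ := h.exists_pow_eq'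
    refine ⟨k % Function.minimalPeriod σ m, Nat.mod_lt _ hpos, ?_⟩
    rw [Function.iterate_mod_minimalPeriod_eq, Equiv.Perm.iterate_eq_pow, hk]

theorem nodup_cycleFrom {n : ℕ} (σ : Perm (Fin n)) (m : Fin n) : (cycleFrom σ m).Nodup := by
  rw [cycleFrom, List.nodup_iff_injective_get]
  intro a b h
  have ha := a.2
  have hb := b.2
  simp only [List.length_iterate] at ha hb
  simp only [List.get_eq_getElem, List.getElem_iterate] at h
  exact Fin.ext (Function.iterate_injOn_Iio_minimalPeriod ha hb h)

theorem nodup_fundamentalWord {n : ℕ} (σ : Perm (Fin n)) : (fundamentalWord σ).Nodup := by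
  rw [fundamentalWord, List.nodup_flatMap]
  refine ⟨fun m _ => nodup_cycleFrom σ m, ?_⟩
  have hn : (cycleMaxima σ).Nodup := (List.nodup_finRange n).filter _
  refine hn.imp_of_mem ?_
  intro a b ha hb hab
  simp only [cycleMaxima, List.mem_filter, decide_eq_true_eq] at ha hb
  intro x hxa hxb
  rw [mem_cycleFrom] at hxa hxb
  exact hab (le_antisymm (hb.2 a (hxb.trans hxa.symm)) (ha.2 b (hxa.trans hxb.symm)))

theorem mem_fundamentalWord {n : ℕ} (σ : Perm (Fin n)) (x : Fin n) : x ∈ fundamentalWord σ := by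
  classical
  have hne : (Finset.univ.filter fun y => σ.SameCycle x y).Nonempty :=
    ⟨x, by simp [Equiv.Perm.SameCycle.refl]⟩
  obtain ⟨m, hm, hmax⟩ := Finset.exists_max_image _ id hne
  simp only [Finset.mem_filter, Finset.mem_univ, true_and, id] at hm hmax
  rw [fundamentalWord, List.mem_flatMap]
  refine ⟨m, ?_, (mem_cycleFrom σ m x).2 hm.symm⟩
  simp only [cycleMaxima, List.mem_filter, decide_eq_true_eq]
  exact ⟨List.mem_finRange m, fun y hy => hmax y (hm.trans hy)⟩

theorem length_fundamentalWord {n : ℕ} (σ : Perm (Fin n)) : (fundamentalWord σ).length = n := by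
  rw [← List.toFinset_card_of_nodup (nodup_fundamentalWord σ),
    Finset.eq_univ_of_forall fun x => List.mem_toFinset.2 (mem_fundamentalWord σ x),
    Finset.card_univ, Fintype.card_fin]

/-- The image `Φ(σ)` of `σ` under the fundamental bijection: the permutation whose one-line
notation is `fundamentalWord σ`. -/
noncomputable def fundamental {n : ℕ} (σ : Perm (Fin n)) : Perm (Fin n) :=
  Equiv.ofBijective
    (fun i => (fundamentalWord σ).get (i.cast (length_fundamentalWord σ).symm))
    (Finite.injective_iff_bijective.1 fun _ _ h =>
      Fin.cast_injective _ (List.nodup_iff_injective_get.1 (nodup_fundamentalWord σ) h))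

/-! ### Vincular patterns -/

/-- A vincular pattern: a permutation, together with the set of those positions `i` (counted from
`0`) for which the symbols at positions `i` and `i + 1` are bonded. -/
structure VincularPattern (k : ℕ) where
  /-- the underlying permutation, in one-line notation -/
  perm : Perm (Fin k)
  /-- the bonds -/
  bonds : Set ℕ

/-- `τ` contains the vincular pattern `p`: some subsequence of the one-line notation of `τ`, at the
positions `f 0 < f 1 < …`, is in the same relative order as `p.perm`, and bonded
symbols are in consecutive positions of `τ`. -/
def Contains {n k : ℕ} (τ : Perm (Fin n)) (p : VincularPattern k) : Prop :=
  ∃ f : Fin k → Fin n, StrictMono f ∧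
    (∀ i j : Fin k, τ (f i) ≤ τ (f j) ↔ p.perm i ≤ p.perm j) ∧
    ∀ i j : Fin k, (i : ℕ) ∈ p.bonds → (j : ℕ) = i + 1 → ((f j : ℕ) = f i + 1)

/-- `τ` avoids the vincular pattern `p`. -/
def Avoids {n k : ℕ} (τ : Perm (Fin n)) (p : VincularPattern k) : Prop := ¬ Contains τ p

/-- The vincular pattern with underlying permutation `3142` in which `3, 1` are bonded and
`4, 2` are bonded. -/
def pattern3142 : VincularPattern 4 where
  perm := ⟨![2, 0, 3, 1], ![1, 3, 0, 2], by decide, by decide⟩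
  bonds := {0, 2}

/-! ### Motzkin numbers and chord diagrams -/

/-- The Motzkin numbers `1, 1, 2, 4, 9, 21, 51, …`. -/
def motzkin : ℕ → ℕ
  | 0 => 1
  | n + 1 => motzkin n + ∑ i : Fin n, motzkin i * motzkin (n - 1 - i)
decreasing_by
  · omega
  · omega
  · omega

/-- A set of chords, each joining two distinct points among `n` labelled points on a circle
(in this cyclic order), is a partial chord diagram if distinct chords share no endpoint. -/
def IsChordDiagram {n : ℕ} (D : Set (Sym2 (Fin n))) : Prop :=
  (∀ e ∈ D, ¬ e.IsDiag) ∧ ∀ e ∈ D, ∀ e' ∈ D, ∀ v : Fin n, v ∈ e → v ∈ e' → e = e'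

/-- No two chords cross: chords cross when their endpoints alternate around the circle. -/
def IsNoncrossing {n : ℕ} (D : Set (Sym2 (Fin n))) : Prop :=
  ∀ a b c d : Fin n, a < b → b < c → c < d → ¬ (s(a, c) ∈ D ∧ s(b, d) ∈ D)

/-- The chords joining distinct points that lie in the same cycle of `σ`. -/
def chords {n : ℕ} (σ : Perm (Fin n)) : Set (Sym2 (Fin n)) :=
  {e | ∃ i j : Fin n, i ≠ j ∧ σ.SameCycle i j ∧ e = s(i, j)}

/-- The shallow involutions in `S_n`. An involution is a permutation all of whose cycles have
length one or two; the identity is included. -/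
def shallowInvolutions (n : ℕ) : Set (Perm (Fin n)) :=
  {σ | Function.Involutive σ ∧ IsShallow σ}

/-- The noncrossing partial chord diagrams on `n` points. -/
def noncrossingChordDiagrams (n : ℕ) : Set (Set (Sym2 (Fin n))) :=
  {D | IsChordDiagram D ∧ IsNoncrossing D}

end ShallowPerm

namespace ShallowPerm

open Equiv

/-! ### Length and reflection length -/

section WordLength

variable {n : ℕ} {A : Set (Perm (Fin n))}

/-! Draw an involution as a set of arcs `i → σ i` with `i < σ i`. Its depth is the number of arcs
plus the number of pairs (arc, point strictly under it). Its length is its inversion number, namely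
the number of arcs plus twice the number of those pairs `(i, j)` with `σ j < σ i`
(`card_inversions_involutive`). Its reflection length is the number of arcs. Hence twice the depth
is the sum of the two lengths plus twice the number of crossings (`two_mul_depth`), and shallow
means noncrossing.

For an involution, `Φ` lists blocks `m` or `m, σ m` by increasing maximum `m`, so the only descents
are inside the two-letter blocks. An occurrence of the pattern is then a pair of arcs, and its order
relations say that they cross (`contains_fundamental_iff`).

Involutions are the same as partial chord diagrams, with crossing arcs as crossing chords. Removing
the first point, or the arc from it, gives the Motzkin recurrence. The count is done with maps on
`ℕ` supported in an interval, so that subintervals need no relabelling. -/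

theorem wordLength_prod_le (l : List (Perm (Fin n))) (hl : ∀ a ∈ l, a ∈ A) :
    wordLength A l.prod ≤ l.length := Nat.sInf_le ⟨l, hl, rfl, rfl⟩

theorem le_wordLength {σ : Perm (Fin n)} {k : ℕ}
    (hne : ∃ l : List (Perm (Fin n)), (∀ a ∈ l, a ∈ A) ∧ l.prod = σ)
    (h : ∀ l : List (Perm (Fin n)), (∀ a ∈ l, a ∈ A) → l.prod = σ → k ≤ l.length) :
    k ≤ wordLength A σ := by
  obtain ⟨l, hl, hp⟩ := hne
  refine le_csInf ⟨l.length, l, hl, hp, rfl⟩ ?_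
  rintro _ ⟨l', hl', hp', rfl⟩
  exact h l' hl' hp'

end WordLength

/-! ### Coxeter length as inversion number. -/

/-- The inversions of a permutation, as pairs of positions. -/
def inversions {n : ℕ} (σ : Perm (Fin n)) : Finset (Fin n × Fin n) :=
  {p | p.1 < p.2 ∧ σ p.2 < σ p.1}

@[simp] theorem mem_inversions {n : ℕ} {σ : Perm (Fin n)} {p : Fin n × Fin n} :
    p ∈ inversions σ ↔ p.1 < p.2 ∧ σ p.2 < σ p.1 := by simp [inversions]

/-- No letter lies strictly between `a` and `b`, so `(a, b)` is the only pair whose order the swap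
reverses. -/
theorem swap_adjacent_lt {n : ℕ} {a b : Fin n} (hab : (b : ℕ) = a + 1) {i j : Fin n}
    (hij : i < j) (hne : (i, j) ≠ (a, b)) : swap a b i < swap a b j := by
  have hne' : i = a → j ≠ b := by rintro rfl rfl; exact hne rfl
  simp only [Equiv.swap_apply_def]
  simp only [Fin.lt_def, Fin.ext_iff] at *
  split_ifs <;> omega

theorem card_inversions_erase_mul_swap {n : ℕ} (σ : Perm (Fin n)) {a b : Fin n}
    (hab : (b : ℕ) = a + 1) :
    ((inversions (σ * swap a b)).erase (a, b)).card = ((inversions σ).erase (a, b)).card := by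
  have hlt : a < b := by rw [Fin.lt_def]; omega
  -- Stated for every `τ`: applied to `σ * swap a b`, it also gives the inverse map.
  have key : ∀ τ : Perm (Fin n), Set.MapsTo (Prod.map (swap a b) (swap a b))
      ((inversions (τ * swap a b)).erase (a, b) : Finset (Fin n × Fin n))
      ((inversions τ).erase (a, b) : Finset (Fin n × Fin n)) := by
    rintro τ ⟨i, j⟩ h
    simp only [Finset.mem_coe, Finset.mem_erase, mem_inversions, Perm.mul_apply, Prod.map] at h ⊢
    refine ⟨fun he => ?_, swap_adjacent_lt hab h.2.1 h.1, h.2.2⟩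
    simp only [Prod.mk.injEq] at he
    have hi : i = b := by rw [← swap_apply_self a b i, he.1, swap_apply_left]
    have hj : j = a := by rw [← swap_apply_self a b j, he.2, swap_apply_right]
    exact absurd h.2.1 (by rw [hi, hj]; exact hlt.asymm)
  refine Finset.card_nbij' (Prod.map (swap a b) (swap a b)) (Prod.map (swap a b) (swap a b))
    (key σ) ?_ (fun p _ => by simp [Prod.map]) (fun p _ => by simp [Prod.map])
  have := key (σ * swap a b)
  rwa [mul_assoc, swap_mul_self, mul_one] at this

theorem card_inversions_mul_swap_le {n : ℕ} (σ : Perm (Fin n)) {a b : Fin n}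
    (hab : (b : ℕ) = a + 1) :
    (inversions (σ * swap a b)).card ≤ (inversions σ).card + 1 := by
  have h1 := Finset.pred_card_le_card_erase (s := inversions (σ * swap a b)) (a := (a, b))
  have h2 := Finset.card_erase_le (s := inversions σ) (a := (a, b))
  rw [card_inversions_erase_mul_swap σ hab] at h1
  omega

theorem card_inversions_mul_swap_of_descent {n : ℕ} (σ : Perm (Fin n)) {a b : Fin n}
    (hab : (b : ℕ) = a + 1) (h : σ b < σ a) :
    (inversions (σ * swap a b)).card + 1 = (inversions σ).card := by
  have hlt : a < b := by rw [Fin.lt_def]; omega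
  have h1 : (a, b) ∈ inversions σ := by simp [h, hlt]
  have h2 : (a, b) ∉ inversions (σ * swap a b) := by simp [h.le]
  rw [← Finset.card_erase_add_one h1, ← card_inversions_erase_mul_swap σ hab,
    Finset.erase_eq_of_notMem h2]

theorem card_inversions_prod_le {n : ℕ} (l : List (Perm (Fin n)))
    (hl : ∀ a ∈ l, a ∈ simpleReflections n) : (inversions l.prod).card ≤ l.length := by
  induction l using List.reverseRecOn with
  | nil =>
    rw [List.prod_nil, List.length_nil, Nat.le_zero, Finset.card_eq_zero]
    ext p
    simp only [mem_inversions, Perm.one_apply, Finset.notMem_empty, iff_false, not_and, not_lt]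
    exact le_of_lt
  | append_singleton l s ih =>
    obtain ⟨a, b, hab, rfl⟩ := hl s (by simp)
    rw [List.prod_append, List.prod_singleton, List.length_append, List.length_singleton]
    exact (card_inversions_mul_swap_le _ hab).trans
      (Nat.add_le_add_right (ih fun x hx => hl x (by simp [hx])) 1)

/-- Without an adjacent descent `σ` is strictly increasing, and the identity is the only order
automorphism of `Fin n`. -/
theorem exists_adjacent_descent {n : ℕ} {σ : Perm (Fin n)} (hσ : σ ≠ 1) :
    ∃ a b : Fin n, (b : ℕ) = a + 1 ∧ σ b < σ a := by
  by_contra! h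
  apply hσ
  have hmono : StrictMono σ := by
    cases n with
    | zero => exact fun i => i.elim0
    | succ n =>
      rw [Fin.strictMono_iff_lt_succ]
      exact fun i => lt_of_le_of_ne (h i.castSucc i.succ (by simp))
        (σ.injective.ne (Fin.castSucc_lt_succ).ne)
  have := Subsingleton.elim (hmono.orderIsoOfSurjective σ σ.surjective) (OrderIso.refl _)
  ext i
  exact congrArg Fin.val (DFunLike.congr_fun this i)

/-- Bubble sort: undoing an adjacent descent removes exactly one inversion. -/
theorem exists_simpleReflections_word_card_inversions {n : ℕ} (k : ℕ) :
    ∀ σ : Perm (Fin n), (inversions σ).card = k →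
      ∃ l : List (Perm (Fin n)), (∀ a ∈ l, a ∈ simpleReflections n) ∧ l.prod = σ ∧
        l.length = k := by
  induction k with
  | zero =>
    intro σ hσ
    refine ⟨[], by simp, ?_, rfl⟩
    by_contra hne
    obtain ⟨a, b, hab, h⟩ := exists_adjacent_descent (Ne.symm hne)
    have := card_inversions_mul_swap_of_descent σ hab h
    omega
  | succ k ih =>
    intro σ hσ
    have hne : σ ≠ 1 := by
      rintro rfl
      have := card_inversions_prod_le ([] : List (Perm (Fin n))) (by simp)
      simp only [List.prod_nil, List.length_nil] at this
      omega
    obtain ⟨a, b, hab, h⟩ := exists_adjacent_descent hne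
    have := card_inversions_mul_swap_of_descent σ hab h
    obtain ⟨l, hl, hp, hk⟩ := ih (σ * swap a b) (by omega)
    refine ⟨l ++ [swap a b], ?_, ?_, by simp [hk]⟩
    · intro x hx
      rcases List.mem_append.1 hx with hx | hx
      · exact hl x hx
      · exact ⟨a, b, hab, by simpa using hx⟩
    · rw [List.prod_append, hp, List.prod_singleton, mul_assoc, swap_mul_self, mul_one]

/-- The Coxeter length of a permutation is its number of inversions. -/
theorem length_eq_card_inversions {n : ℕ} (σ : Perm (Fin n)) :
    length σ = (inversions σ).card := by
  refine le_antisymm ?_ (le_wordLength (exists_simpleReflections_word σ) ?_)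
  · obtain ⟨l, hl, hp, hk⟩ := exists_simpleReflections_word_card_inversions _ σ rfl
    rw [← hk, ← hp]
    exact wordLength_prod_le l hl
  · rintro l hl rfl
    exact card_inversions_prod_le l hl

/-! ### Reflection length of an involution. -/

/-- The reflections are exactly the transpositions. -/
theorem mem_reflections_iff {n : ℕ} {t : Perm (Fin n)} :
    t ∈ reflections n ↔ ∃ a b : Fin n, a ≠ b ∧ t = swap a b := by
  constructor
  · rintro ⟨g, _, ⟨a, b, hab, rfl⟩, rfl⟩
    refine ⟨g a, g b, g.injective.ne ?_, ?_⟩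
    · rintro rfl; omega
    · rw [Equiv.swap_apply_apply]
  · rintro ⟨a, b, hab, rfl⟩
    have hn : 1 < n := by
      have := a.2; have := b.2
      have : (a : ℕ) ≠ b := Fin.val_ne_of_ne hab
      omega
    -- All transpositions are conjugate, so any simple one will do; the one on the letters `0`, `1`
    -- exists because `1 < n`.
    obtain ⟨g, hg⟩ := isConj_iff.1 (Perm.isConj_swap
      (show (⟨0, by omega⟩ : Fin n) ≠ ⟨1, hn⟩ by simp) hab)
    exact ⟨g, _, ⟨_, _, rfl, rfl⟩, hg.symm⟩

/-- The excedances of a permutation. -/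
def excedances {n : ℕ} (σ : Perm (Fin n)) : Finset (Fin n) := {i | i < σ i}

@[simp] theorem mem_excedances {n : ℕ} {σ : Perm (Fin n)} {i : Fin n} :
    i ∈ excedances σ ↔ i < σ i := by simp [excedances]

/-- Supplies the lower bound on reflection length. A transposition of `a` and `b` changes each basis
vector by `0` or `±(e_b - e_a)`, so each factor enlarges the space of displacements by at most one
dimension. -/
theorem exists_submodule_of_reflections_word {n : ℕ} (l : List (Perm (Fin n)))
    (hl : ∀ a ∈ l, a ∈ reflections n) :
    ∃ W : Submodule ℚ (Fin n → ℚ), Module.finrank ℚ W ≤ l.length ∧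
      ∀ i, Pi.single (l.prod i) 1 - Pi.single i 1 ∈ W := by
  induction l with
  | nil => exact ⟨⊥, by simp, by simp⟩
  | cons s l ih =>
    obtain ⟨W, hW, h⟩ := ih fun a ha => hl a (by simp [ha])
    obtain ⟨a, b, hab, rfl⟩ := mem_reflections_iff.1 (hl s (by simp))
    let v : Fin n → ℚ := Pi.single b 1 - Pi.single a 1
    refine ⟨Submodule.span ℚ {v} ⊔ W, ?_, fun i => ?_⟩
    · have h1 := Submodule.finrank_add_le_finrank_add_finrank (Submodule.span ℚ {v}) W
      have h2 := finrank_span_le_card (R := ℚ) ({v} : Set (Fin n → ℚ))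
      simp only [Set.toFinset_singleton, Finset.card_singleton] at h2
      rw [List.length_cons]
      omega
    · have hv : v ∈ Submodule.span ℚ {v} ⊔ W :=
        Submodule.mem_sup_left (Submodule.mem_span_singleton_self v)
      have hs : ∀ j, (Pi.single (swap a b j) 1 - Pi.single j 1 : Fin n → ℚ) ∈
          Submodule.span ℚ {v} ⊔ W := by
        intro j
        by_cases hja : j = a
        · subst hja; simpa using hv
        · by_cases hjb : j = b
          · subst hjb
            have := neg_mem hv
            simp only [v, neg_sub] at this
            rwa [swap_apply_right]
          · rw [swap_apply_of_ne_of_ne hja hjb, sub_self]; exact zero_mem _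
      have := add_mem (hs (l.prod i)) (Submodule.mem_sup_right (h i))
      rwa [sub_add_sub_cancel] at this

/-- Coordinate `i` sees only the `i`-th vector: the upper end of an arc of an involution is never
the lower end of another. -/
theorem linearIndependent_excedances {n : ℕ} {σ : Perm (Fin n)} (hσ : Function.Involutive σ) :
    LinearIndependent ℚ fun i : excedances σ =>
      (Pi.single (σ i) 1 - Pi.single (i : Fin n) 1 : Fin n → ℚ) := by
  rw [Fintype.linearIndependent_iff]
  intro g hg i
  have h := congrFun hg i
  rw [Finset.sum_apply, Finset.sum_eq_single i] at h
  · have hi := mem_excedances.1 i.2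
    simpa [Pi.single_apply, hi.ne] using h
  · intro j _ hji
    have hi := mem_excedances.1 i.2
    have hj := mem_excedances.1 j.2
    have h1 : (i : Fin n) ≠ σ j := by
      intro he
      rw [he, hσ] at hi
      exact hi.asymm hj
    have h2 : (i : Fin n) ≠ j := fun he => hji (Subtype.ext he.symm)
    simp [h1, h2]
  · simp

/-- Multiplying by the transposition of `a` and `σ a` turns that two-cycle into fixed points and
leaves the rest alone, so the involution loses just one excedance. -/
theorem exists_reflections_word_card_excedances {n : ℕ} (k : ℕ) :
    ∀ σ : Perm (Fin n), Function.Involutive σ → (excedances σ).card = k →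
      ∃ l : List (Perm (Fin n)), (∀ a ∈ l, a ∈ reflections n) ∧ l.prod = σ ∧ l.length = k := by
  induction k with
  | zero =>
    intro σ hσ h0
    refine ⟨[], by simp, ?_, rfl⟩
    have hle : ∀ i, σ i ≤ i := by
      intro i
      by_contra! hi
      have : i ∈ excedances σ := mem_excedances.2 hi
      rw [Finset.card_eq_zero.1 h0] at this
      simp at this
    ext i
    exact congrArg Fin.val (le_antisymm (by simpa [hσ i] using hle (σ i)) (hle i))
  | succ k ih =>
    intro σ hσ hk
    obtain ⟨a, ha⟩ : (excedances σ).Nonempty := by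
      rw [← Finset.card_pos]; omega
    have hval : ∀ x, (σ * swap a (σ a)) x = if x = a ∨ x = σ a then x else σ x := by
      intro x
      rw [Perm.mul_apply, swap_apply_def]
      have := hσ a
      grind
    have hex : excedances (σ * swap a (σ a)) = (excedances σ).erase a := by
      ext x
      rw [Finset.mem_erase, mem_excedances, mem_excedances, hval]
      have := hσ a
      have := mem_excedances.1 ha
      grind
    obtain ⟨l, hl, hp, hlen⟩ := ih (σ * swap a (σ a))
      (by
        intro x
        rw [hval, hval]
        have := hσ a
        have := hσ x
        grind)
      (by rw [hex, Finset.card_erase_of_mem ha]; omega)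
    refine ⟨l ++ [swap a (σ a)], ?_, ?_, by simp [hlen]⟩
    · intro x hx
      rcases List.mem_append.1 hx with hx | hx
      · exact hl x hx
      · exact mem_reflections_iff.2 ⟨a, σ a, (mem_excedances.1 ha).ne, by simpa using hx⟩
    · rw [List.prod_append, hp, List.prod_singleton, mul_assoc, swap_mul_self, mul_one]

/-- The reflection length of an involution is its number of two-element cycles. -/
theorem reflectionLength_eq_card_excedances {n : ℕ} {σ : Perm (Fin n)}
    (hσ : Function.Involutive σ) : reflectionLength σ = (excedances σ).card := by
  obtain ⟨l, hl, hp, hk⟩ := exists_reflections_word_card_excedances _ σ hσ rfl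
  refine le_antisymm ?_ (le_wordLength ⟨l, hl, hp⟩ ?_)
  · rw [← hk, ← hp]
    exact wordLength_prod_le l hl
  · intro l' hl' hp'
    obtain ⟨W, hW, h⟩ := exists_submodule_of_reflections_word l' hl'
    rw [hp'] at h
    -- The independent displacements along the arcs all lie in `W`, which bounds their number by the
    -- word length.
    have hspan := finrank_span_eq_card (linearIndependent_excedances hσ)
    rw [Fintype.card_coe] at hspan
    rw [← hspan]
    refine (Submodule.finrank_mono (Submodule.span_le.2 ?_)).trans hW
    rintro _ ⟨i, rfl⟩
    exact h i

/-! ### Shallow involutions are noncrossing -/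

/-- A permutation is noncrossing if no two of its arcs `i → σ i` with `i < σ i` cross. -/
def PermNoncrossing {n : ℕ} (σ : Perm (Fin n)) : Prop :=
  ∀ i j : Fin n, i < j → j < σ i → ¬ σ i < σ j

/-- The pairs `(i, j)` for which `j` lies strictly under the arc `i → σ i`. -/
def covered {n : ℕ} (σ : Perm (Fin n)) : Finset (Fin n × Fin n) := {p | p.1 < p.2 ∧ p.2 < σ p.1}

/-- An arc contributes `σ i - i`, which is one more than the number of points strictly under it. -/
theorem depth_eq_card {n : ℕ} (σ : Perm (Fin n)) :
    depth σ = (excedances σ).card + (covered σ).card := by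
  have h : (covered σ).card = ∑ i ∈ excedances σ, (Finset.Ioo i (σ i)).card := by
    rw [← Finset.card_sigma]
    refine Finset.card_nbij' (fun p => ⟨p.1, p.2⟩) (fun p => (p.1, p.2)) ?_ ?_
      (fun _ _ => rfl) (fun _ _ => rfl)
    · intro p hp
      simp only [covered, Finset.coe_filter, Finset.mem_univ, true_and, Set.mem_ofPred_eq] at hp
      simpa using ⟨hp.1.trans hp.2, hp⟩
    · intro p hp
      have hp : p.1 < σ p.1 ∧ p.1 < p.2 ∧ p.2 < σ p.1 := by simpa using hp
      simpa [covered] using hp.2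
  rw [h, Finset.card_eq_sum_ones, ← Finset.sum_add_distrib, depth]
  refine Finset.sum_congr rfl fun i hi => ?_
  have := (Finset.mem_filter.1 hi).2
  rw [Fin.card_Ioo]
  rw [Fin.lt_def] at this
  omega

/-- The crossings of an involution. -/
def crossings {n : ℕ} (σ : Perm (Fin n)) : Finset (Fin n × Fin n) :=
  {p ∈ covered σ | σ p.1 < σ p.2}

theorem card_covered {n : ℕ} (σ : Perm (Fin n)) :
    (covered σ).card = {p ∈ covered σ | σ p.2 < σ p.1}.card + (crossings σ).card := by
  rw [crossings, ← Finset.card_filter_add_card_filter_not (s := covered σ)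
    (fun p => σ p.2 < σ p.1)]
  congr 2
  refine Finset.filter_congr fun p hp => ?_
  have := (Finset.mem_filter.1 hp).2.1
  rw [not_lt]
  exact ⟨fun h => lt_of_le_of_ne h (σ.injective.ne this.ne), le_of_lt⟩

/-- Compare `j` with `σ i` for an inversion `(i, j)`. Equality gives the arcs; the map `(i, j) ↦ (σ
j, σ i)` exchanges the cases `j < σ i` and `σ i < j`, whence the factor two. -/
theorem card_inversions_involutive {n : ℕ} {σ : Perm (Fin n)} (hσ : Function.Involutive σ) :
    (inversions σ).card =
      (excedances σ).card + 2 * {p ∈ covered σ | σ p.2 < σ p.1}.card := by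
  have h0 : {p ∈ inversions σ | p.2 = σ p.1}.card = (excedances σ).card := by
    refine Finset.card_nbij' (fun p => p.1) (fun i => (i, σ i)) ?_ ?_ ?_ ?_
    · rintro ⟨i, j⟩ h
      simp only [Finset.coe_filter, Set.mem_ofPred_eq, mem_inversions] at h
      obtain ⟨h, rfl⟩ := h
      simpa using h.1
    · intro i h
      simpa [hσ i] using h
    · rintro ⟨i, j⟩ h
      simp only [Finset.coe_filter, Set.mem_ofPred_eq, mem_inversions] at h
      simp [h.2]
    · intro i _; rfl
  have h1 : {p ∈ inversions σ | p.2 < σ p.1} = {p ∈ covered σ | σ p.2 < σ p.1} := by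
    ext p
    simp only [covered, Finset.mem_filter, mem_inversions, Finset.mem_univ, true_and]
    tauto
  have h2 : {p ∈ inversions σ | σ p.1 < p.2}.card = {p ∈ inversions σ | p.2 < σ p.1}.card := by
    refine Finset.card_nbij' (fun p => (σ p.2, σ p.1)) (fun p => (σ p.2, σ p.1)) ?_ ?_ ?_ ?_
    · intro p h
      simp only [Finset.coe_filter, Set.mem_ofPred_eq, mem_inversions, hσ p.1, hσ p.2] at h ⊢
      tauto
    · intro p h
      simp only [Finset.coe_filter, Set.mem_ofPred_eq, mem_inversions, hσ p.1, hσ p.2] at h ⊢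
      tauto
    · intro p _; simp [hσ p.1, hσ p.2]
    · intro p _; simp [hσ p.1, hσ p.2]
  have h3 := Finset.card_filter_add_card_filter_not (s := inversions σ) (fun p => p.2 = σ p.1)
  have h4 := Finset.card_filter_add_card_filter_not
    (s := {p ∈ inversions σ | ¬ p.2 = σ p.1}) (fun p => p.2 < σ p.1)
  rw [Finset.filter_filter, Finset.filter_filter] at h4
  have h5 : {p ∈ inversions σ | ¬ p.2 = σ p.1 ∧ p.2 < σ p.1} =
      {p ∈ inversions σ | p.2 < σ p.1} :=
    Finset.filter_congr fun p _ => ⟨fun h => h.2, fun h => ⟨h.ne, h⟩⟩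
  have h6 : {p ∈ inversions σ | ¬ p.2 = σ p.1 ∧ ¬ p.2 < σ p.1} =
      {p ∈ inversions σ | σ p.1 < p.2} :=
    Finset.filter_congr fun p _ => ⟨fun h => lt_of_le_of_ne (not_lt.1 h.2) (Ne.symm h.1),
      fun h => ⟨h.ne', h.asymm⟩⟩
  rw [h5, h6, h2, h1] at h4
  omega

/-- Twice the depth of an involution exceeds the sum of its two lengths by twice the number
of its crossings. -/
theorem two_mul_depth {n : ℕ} {σ : Perm (Fin n)} (hσ : Function.Involutive σ) :
    2 * depth σ = length σ + reflectionLength σ + 2 * (crossings σ).card := by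
  rw [depth_eq_card, length_eq_card_inversions, reflectionLength_eq_card_excedances hσ,
    card_inversions_involutive hσ, card_covered σ]
  ring

theorem isShallow_iff_permNoncrossing {n : ℕ} {σ : Perm (Fin n)} (hσ : Function.Involutive σ) :
    IsShallow σ ↔ PermNoncrossing σ := by
  have h := two_mul_depth hσ
  have h' : IsShallow σ ↔ (crossings σ).card = 0 := by
    have hq : (2 * depth σ : ℚ) = length σ + reflectionLength σ + 2 * (crossings σ).card := by
      exact_mod_cast h
    rw [IsShallow, ← Nat.cast_eq_zero (R := ℚ)]
    constructor <;> intro h <;> linarith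
  rw [h', Finset.card_eq_zero, crossings, Finset.filter_eq_empty_iff, PermNoncrossing]
  simp [covered]

/-! ### The fundamental bijection on involutions -/

theorem cycleFrom_of_fixed {n : ℕ} {σ : Perm (Fin n)} {m : Fin n} (h : σ m = m) :
    cycleFrom σ m = [m] := by
  have : Function.minimalPeriod σ m = 1 := Function.minimalPeriod_eq_one_iff_isFixedPt.2 h
  rw [cycleFrom, this]
  rfl

theorem cycleFrom_of_involutive {n : ℕ} {σ : Perm (Fin n)} (hσ : Function.Involutive σ)
    {m : Fin n} (h : σ m ≠ m) : cycleFrom σ m = [m, σ m] := by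
  have : Function.minimalPeriod σ m = 2 :=
    Function.minimalPeriod_eq_prime (p := 2) (hσ m) h
  rw [cycleFrom, this]
  rfl

theorem sameCycle_iff_of_involutive {n : ℕ} {σ : Perm (Fin n)} (hσ : Function.Involutive σ)
    {i j : Fin n} : σ.SameCycle i j ↔ j = i ∨ j = σ i := by
  rw [← mem_cycleFrom]
  by_cases h : σ i = i
  · simp [cycleFrom_of_fixed h, h]
  · simp [cycleFrom_of_involutive hσ h]

theorem mem_cycleMaxima_of_involutive {n : ℕ} {σ : Perm (Fin n)} (hσ : Function.Involutive σ)
    {m : Fin n} : m ∈ cycleMaxima σ ↔ σ m ≤ m := by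
  simp only [cycleMaxima, List.mem_filter, List.mem_finRange, true_and, decide_eq_true_eq,
    sameCycle_iff_of_involutive hσ]
  exact ⟨fun h => h _ (Or.inr rfl), fun h x hx => by rcases hx with rfl | rfl <;> simp [h]⟩

theorem pairwise_cycleMaxima {n : ℕ} (σ : Perm (Fin n)) :
    (cycleMaxima σ).Pairwise (· < ·) := (List.pairwise_lt_finRange n).filter _

theorem isChain_flatMap_cycleFrom {n : ℕ} {σ : Perm (Fin n)} (hσ : Function.Involutive σ)
    (L : List (Fin n)) (hL : L.Pairwise (· < ·)) (hm : ∀ m ∈ L, σ m ≤ m) :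
    (L.flatMap (cycleFrom σ)).IsChain fun x y => y < x → σ x = y := by
  induction L with
  | nil => simp
  | cons m L ih =>
    rw [List.flatMap_cons, List.isChain_append]
    rw [List.pairwise_cons] at hL
    refine ⟨?_, ih hL.2 fun x hx => hm x (by simp [hx]), ?_⟩
    · by_cases h : σ m = m
      · simp [cycleFrom_of_fixed h]
      · simp [cycleFrom_of_involutive hσ h]
    -- Between blocks there is an ascent: the last letter is at most `m`, and the next block starts
    -- with a larger maximum.
    · intro x hx y hy hyx
      exfalso
      have hxm : x ≤ m := by
        have hmem := List.mem_of_getLast? hx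
        rw [mem_cycleFrom, sameCycle_iff_of_involutive hσ] at hmem
        rcases hmem with rfl | rfl
        · exact le_rfl
        · exact hm m (by simp)
      have hym : m < y := by
        cases L with
        | nil => simp at hy
        | cons m' L =>
          have : y = m' := by
            by_cases h : σ m' = m'
            · simpa [cycleFrom_of_fixed h, eq_comm] using hy
            · simpa [cycleFrom_of_involutive hσ h, eq_comm] using hy
          rw [this]
          exact hL.1 m' (by simp)
      exact absurd (hyx.trans_le hxm) hym.asymm

theorem fundamental_apply {n : ℕ} (σ : Perm (Fin n)) (i : Fin n) :
    fundamental σ i =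
      (fundamentalWord σ)[(i : ℕ)]'(by rw [length_fundamentalWord]; exact i.2) := rfl

/-- The descents of `Φ(σ)`, for an involution `σ`, come from two-element cycles. -/
theorem apply_fundamental_of_descent {n : ℕ} {σ : Perm (Fin n)} (hσ : Function.Involutive σ)
    {i j : Fin n} (hij : (j : ℕ) = i + 1) (h : fundamental σ j < fundamental σ i) :
    σ (fundamental σ i) = fundamental σ j := by
  have hc := isChain_flatMap_cycleFrom hσ (cycleMaxima σ) (pairwise_cycleMaxima σ)
    fun m hm => (mem_cycleMaxima_of_involutive hσ).1 hm
  rw [List.isChain_iff_getElem] at hc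
  have hlen : (i : ℕ) + 1 < (fundamentalWord σ).length := by
    rw [length_fundamentalWord, ← hij]; exact j.2
  have := hc i hlen
  rw [fundamental_apply, fundamental_apply] at h ⊢
  simp only [hij] at h ⊢
  exact this h

/-- Locates the blocks of two two-cycles in the word, in order of their maxima, so that positions
for the pattern can be written down. -/
theorem fundamentalWord_eq_append {n : ℕ} {σ : Perm (Fin n)} (hσ : Function.Involutive σ)
    {c d : Fin n} (hc : σ c < c) (hd : σ d < d) (hcd : c < d) :
    ∃ p q r : List (Fin n),
      fundamentalWord σ = p ++ c :: σ c :: (q ++ d :: σ d :: r) := by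
  obtain ⟨L₁, L₂, h₁⟩ :=
    List.append_of_mem ((mem_cycleMaxima_of_involutive hσ (m := c)).2 hc.le)
  have hd' : d ∈ L₂ := by
    have h := (mem_cycleMaxima_of_involutive hσ (m := d)).2 hd.le
    have hp := pairwise_cycleMaxima σ
    rw [h₁] at h hp
    rw [List.pairwise_append] at hp
    rcases List.mem_append.1 h with h | h
    · exact absurd (hp.2.2 d h c (by simp)) hcd.asymm
    · rcases List.mem_cons.1 h with h | h
      · exact absurd h hcd.ne'
      · exact h
  obtain ⟨L₃, L₄, rfl⟩ := List.append_of_mem hd'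
  refine ⟨L₁.flatMap (cycleFrom σ), L₃.flatMap (cycleFrom σ), L₄.flatMap (cycleFrom σ), ?_⟩
  rw [fundamentalWord, h₁]
  simp [cycleFrom_of_involutive hσ hc.ne, cycleFrom_of_involutive hσ hd.ne]

/-- The image under `Φ` of an involution contains the vincular pattern exactly if two arcs of the
involution cross. -/
theorem contains_fundamental_iff {n : ℕ} {σ : Perm (Fin n)} (hσ : Function.Involutive σ) :
    Contains (fundamental σ) pattern3142 ↔ ∃ i j : Fin n, i < j ∧ j < σ i ∧ σ i < σ j := by
  constructor
  · rintro ⟨f, -, hord, hbond⟩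
    have hlt : ∀ i j : Fin 4, pattern3142.perm i < pattern3142.perm j →
        fundamental σ (f i) < fundamental σ (f j) := by
      intro i j h
      rw [← not_le, hord, not_le]
      exact h
    -- In `3142` the values at positions `1, 3, 0, 2` increase, so both bonded pairs are descents
    -- and hence two-cycles.
    have h13 := hlt 1 3 (by decide)
    have h30 := hlt 3 0 (by decide)
    have h02 := hlt 0 2 (by decide)
    have e1 := apply_fundamental_of_descent hσ
      (hbond 0 1 (by simp [pattern3142]) (by simp)) (h13.trans h30)
    have e2 := apply_fundamental_of_descent hσ
      (hbond 2 3 (by simp [pattern3142]) (by simp)) (h30.trans h02)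
    refine ⟨fundamental σ (f 1), fundamental σ (f 3), h13, ?_, ?_⟩
    · rw [← e1, hσ]; exact h30
    · rw [← e1, ← e2, hσ, hσ]; exact h02
  · rintro ⟨a, b, hab, hba, hcd⟩
    -- The upper ends `σ a` and `σ b` lead their blocks; the letters `σ a, a, σ b, b` will play `3,
    -- 1, 4, 2`.
    obtain ⟨p, q, r, hw⟩ := fundamentalWord_eq_append hσ (c := σ a) (d := σ b)
      (by rw [hσ]; exact hab.trans hba) (by rw [hσ]; exact hba.trans hcd) hcd
    rw [hσ, hσ] at hw
    have hlen := length_fundamentalWord σ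
    rw [hw] at hlen
    simp only [List.length_append, List.length_cons] at hlen
    let f : Fin 4 → Fin n := ![⟨p.length, by omega⟩, ⟨p.length + 1, by omega⟩,
      ⟨p.length + (q.length + 2), by omega⟩, ⟨p.length + (q.length + 3), by omega⟩]
    have v0 : fundamental σ (f 0) = σ a := by
      rw [fundamental_apply]; simp [hw, f]
    have v1 : fundamental σ (f 1) = a := by
      rw [fundamental_apply]; simp [hw, f]
    have v2 : fundamental σ (f 2) = σ b := by
      rw [fundamental_apply]
      simp [hw, f]
    have v3 : fundamental σ (f 3) = b := by
      rw [fundamental_apply]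
      simp [hw, f, List.getElem_append_right]
    refine ⟨f, ?_, ?_, ?_⟩
    · rw [Fin.strictMono_iff_lt_succ]
      intro i
      fin_cases i <;> simp [f]
    · intro i j
      have h1 := hab.trans hba
      have h2 := hba.trans hcd
      have h3 := hab.trans h2
      fin_cases i <;> fin_cases j <;>
        simp [v0, v1, v2, v3, pattern3142, hab, hba, hcd, h1, h2, h3, hab.le, hba.le, hcd.le,
          h1.le, h2.le, h3.le]
    · intro i j hi hj
      have hi : (i : ℕ) = 0 ∨ (i : ℕ) = 2 := by simpa [pattern3142] using hi
      rcases hi with hi | hi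
      · have hi' : i = 0 := Fin.ext hi
        have hj' : j = 1 := Fin.ext (by rw [hj, hi]; rfl)
        subst hi' hj'
        simp [f]
      · have hi' : i = 2 := Fin.ext hi
        have hj' : j = 3 := Fin.ext (by rw [hj, hi]; rfl)
        subst hi' hj'
        simp [f, add_assoc]

/-! ### Counting noncrossing involutions -/

/-- The noncrossing involutions of `ℕ` that fix all points outside the interval `[a, a + m)`. -/
def intervalInvolutions (a m : ℕ) : Set (ℕ → ℕ) :=
  {f | Function.Involutive f ∧ (∀ x, x < a ∨ a + m ≤ x → f x = x) ∧
    ∀ x y, x < y → y < f x → ¬ f x < f y}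

/-- A value outside the interval would be fixed, and then so would `x`, by involutivity. -/
theorem apply_lt_of_mem_intervalInvolutions {a m : ℕ} {f : ℕ → ℕ}
    (hf : f ∈ intervalInvolutions a m) {x : ℕ} (hx : f x ≠ x) : a ≤ f x ∧ f x < a + m := by
  by_contra h
  have := hf.2.1 (f x) (by omega)
  rw [hf.1] at this
  exact hx this.symm

/-- Join two maps by an arc `{a, c}`, where the first map acts below `c` and the second map acts
above `c`. -/
def glue (a c : ℕ) (g h : ℕ → ℕ) (x : ℕ) : ℕ :=
  if x = a then c else if x = c then a else if x < c then g x else h x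

/-- The arc from `a` to `a + k + 1` encloses `k` points and leaves `m - 1 - k` above it. Since `g`
and `h` preserve these two blocks, no new crossing arises. -/
theorem glue_mem {a m k : ℕ} (hk : k < m) {g h : ℕ → ℕ}
    (hg : g ∈ intervalInvolutions (a + 1) k)
    (hh : h ∈ intervalInvolutions (a + k + 2) (m - 1 - k)) :
    glue a (a + k + 1) g h ∈ intervalInvolutions a (m + 1) := by
  have hg' := fun x => @apply_lt_of_mem_intervalInvolutions _ _ _ hg x
  have hh' := fun x => @apply_lt_of_mem_intervalInvolutions _ _ _ hh x
  obtain ⟨g1, g2, g3⟩ := hg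
  obtain ⟨h1, h2, h3⟩ := hh
  refine ⟨fun x => ?_, fun x hx => ?_, fun x y hxy => ?_⟩
  · have := g1 x; have := h1 x; have := hg' x; have := hh' x
    have := g2 x; have := h2 x
    grind [glue]
  · have := g2 x; have := h2 x
    grind [glue]
  · have := hg' x; have := hh' x; have := hg' y; have := hh' y
    have := g2 x; have := h2 x; have := g2 y; have := h2 y
    have := g3 x y hxy; have := h3 x y hxy
    clear g1 g2 g3 h1 h2 h3 hg' hh'
    simp only [glue]
    split_ifs <;> omega

/-- A map restricted to an interval, extended by the identity. -/
def restrict (f : ℕ → ℕ) (a b : ℕ) (x : ℕ) : ℕ := if a ≤ x ∧ x < b then f x else x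

theorem restrict_mem {a m b l : ℕ} {f : ℕ → ℕ} (hf : f ∈ intervalInvolutions a m)
    (h : ∀ x, b ≤ x → x < b + l → b ≤ f x ∧ f x < b + l) :
    restrict f b (b + l) ∈ intervalInvolutions b l := by
  obtain ⟨f1, f2, f3⟩ := hf
  refine ⟨fun x => ?_, fun x hx => ?_, fun x y hxy => ?_⟩
  · have := f1 x; have := h x
    grind [restrict]
  · grind [restrict]
  · have := h x; have := h y; have := f3 x y hxy
    grind [restrict]

theorem mem_intervalInvolutions_succ {a m : ℕ} {f : ℕ → ℕ} :
    f ∈ intervalInvolutions (a + 1) m ↔ f ∈ intervalInvolutions a (m + 1) ∧ f a = a := by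
  constructor
  · rintro ⟨f1, f2, f3⟩
    exact ⟨⟨f1, fun x hx => f2 x (by omega), f3⟩, f2 a (by omega)⟩
  · rintro ⟨⟨f1, f2, f3⟩, ha⟩
    refine ⟨f1, fun x hx => ?_, f3⟩
    by_cases hxa : x = a
    · rw [hxa, ha]
    · exact f2 x (by omega)

/-- A point under the arc cannot be sent past its end without a crossing, nor to its ends, which are
paired with each other. -/
theorem maps_below_arc {a m k : ℕ} {f : ℕ → ℕ} (hf : f ∈ intervalInvolutions a (m + 1))
    (ha : f a = a + k + 1) {x : ℕ} (h1 : a + 1 ≤ x) (h2 : x < a + 1 + k) :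
    a + 1 ≤ f x ∧ f x < a + 1 + k := by
  have h := @apply_lt_of_mem_intervalInvolutions _ _ _ hf x
  obtain ⟨f1, f2, f3⟩ := hf
  have := f3 a x (by omega) (by omega)
  have := f1 a; have := f1 x
  grind

/-- If `f x` were under the arc, then `f (f x) = x` would be too. -/
theorem maps_above_arc {a m k : ℕ} (hk : k < m) {f : ℕ → ℕ}
    (hf : f ∈ intervalInvolutions a (m + 1))
    (ha : f a = a + k + 1) {x : ℕ} (h1 : a + k + 2 ≤ x) (h2 : x < a + k + 2 + (m - 1 - k)) :
    a + k + 2 ≤ f x ∧ f x < a + k + 2 + (m - 1 - k) := by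
  have h := @apply_lt_of_mem_intervalInvolutions _ _ _ hf x
  have hb := @maps_below_arc _ _ _ _ hf ha (f x)
  obtain ⟨f1, f2, f3⟩ := hf
  have := f1 a; have := f1 x
  grind

/-- The involutions pairing `a` with `a + k + 1` split into an involution of the points between
and one of the points above. -/
def splitAtArc (a m k : ℕ) (hk : k < m) :
    {f // f ∈ intervalInvolutions a (m + 1) ∧ f a = a + k + 1} ≃
      intervalInvolutions (a + 1) k × intervalInvolutions (a + k + 2) (m - 1 - k) where
  toFun f := (⟨restrict f (a + 1) (a + 1 + k),
      restrict_mem f.2.1 fun _ h1 h2 => maps_below_arc f.2.1 f.2.2 h1 h2⟩,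
    ⟨restrict f (a + k + 2) (a + k + 2 + (m - 1 - k)),
      restrict_mem f.2.1 fun _ h1 h2 => maps_above_arc hk f.2.1 f.2.2 h1 h2⟩)
  invFun p := ⟨glue a (a + k + 1) p.1 p.2, glue_mem hk p.1.2 p.2.2, by simp [glue]⟩
  left_inv := by
    rintro ⟨f, ⟨f1, f2, f3⟩, ha⟩
    ext x
    have := f1 a; have := f2 x
    simp only [glue, restrict]
    grind
  right_inv := by
    rintro ⟨⟨g, g1, g2, g3⟩, ⟨h, h1, h2, h3⟩⟩
    refine Prod.ext (Subtype.ext (funext fun x => ?_)) (Subtype.ext (funext fun x => ?_))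
    · have := g2 x
      simp only [glue, restrict]
      grind
    · have := h2 x
      simp only [glue, restrict]
      grind

/-- The involutions of an interval, classified by the partner of the first point. -/
def classifyByFirst (a m : ℕ) : intervalInvolutions a (m + 1) ≃
    {f // f ∈ intervalInvolutions a (m + 1) ∧ f a = a} ⊕
      Σ k : Fin m, {f // f ∈ intervalInvolutions a (m + 1) ∧ f a = a + k + 1} where
  toFun f := if h : f.1 a = a then Sum.inl ⟨f, f.2, h⟩
    else Sum.inr ⟨⟨f.1 a - a - 1, by
      have := apply_lt_of_mem_intervalInvolutions f.2 h; omega⟩, f, f.2, by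
      have := apply_lt_of_mem_intervalInvolutions f.2 h; simp only; omega⟩
  invFun := Sum.elim (fun f => ⟨f, f.2.1⟩) (fun p => ⟨p.2, p.2.2.1⟩)
  left_inv f := by
    by_cases h : f.1 a = a <;> simp [h]
  right_inv := by
    rintro (⟨f, hf, h⟩ | ⟨⟨k, hk⟩, f, hf, h⟩)
    · simp [h]
    · have hne : f a ≠ a := by simp only at h; omega
      have hk' : k = f a - a - 1 := by simp only at h; omega
      subst hk'
      simp [hne]

/-- The left endpoint varies because the pieces start at `a + 1` and `a + k + 2`. Finiteness is
carried along since `Nat.card` of a sum needs it. -/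
theorem finite_and_card_intervalInvolutions (m : ℕ) : ∀ a,
    Finite (intervalInvolutions a m) ∧ Nat.card (intervalInvolutions a m) = motzkin m := by
  induction m using Nat.strong_induction_on with
  | _ m ih =>
    intro a
    cases m with
    | zero =>
      have h : intervalInvolutions a 0 = {id} := by
        ext f
        rw [Set.mem_singleton_iff]
        constructor
        · rintro ⟨-, h, -⟩
          exact funext fun x => h x (by omega)
        · rintro rfl
          exact ⟨fun _ => rfl, fun _ _ => rfl, fun x y hxy hyx => absurd hxy hyx.asymm⟩
      rw [h]
      exact ⟨inferInstance, by simp [motzkin]⟩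
    | succ m =>
      have e1 : {f // f ∈ intervalInvolutions a (m + 1) ∧ f a = a} ≃
          intervalInvolutions (a + 1) m :=
        Equiv.subtypeEquivRight fun f => mem_intervalInvolutions_succ.symm
      have e := (classifyByFirst a m).trans (Equiv.sumCongr e1
        (Equiv.sigmaCongrRight fun k : Fin m => splitAtArc a m k k.2))
      have i1 := ih m (by omega) (a + 1)
      have i2 := fun k : Fin m => ih k (by omega) (a + 1)
      have i3 := fun k : Fin m => ih (m - 1 - k) (by omega) (a + k + 2)
      have := i1.1
      have := fun k => (i2 k).1
      have := fun k => (i3 k).1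
      refine ⟨Finite.of_equiv _ e.symm, ?_⟩
      rw [Nat.card_congr e, Nat.card_sum, Nat.card_sigma, i1.2, motzkin]
      congr 1
      refine Finset.sum_congr rfl fun k _ => ?_
      rw [Nat.card_prod, (i2 k).2, (i3 k).2]

/-! ### Transfer between `Fin n` and `ℕ`. -/

/-- A permutation of `Fin n` as a map on `ℕ`. -/
def extend {n : ℕ} (σ : Perm (Fin n)) (x : ℕ) : ℕ := if h : x < n then σ ⟨x, h⟩ else x

theorem extend_coe {n : ℕ} (σ : Perm (Fin n)) (i : Fin n) : extend σ i = σ i := by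
  simp [extend]

theorem extend_of_le {n : ℕ} (σ : Perm (Fin n)) {x : ℕ} (h : n ≤ x) : extend σ x = x := by
  simp [extend, h]

theorem extend_mem_iff {n : ℕ} {σ : Perm (Fin n)} :
    extend σ ∈ intervalInvolutions 0 n ↔ Function.Involutive σ ∧ PermNoncrossing σ := by
  constructor
  · rintro ⟨h1, -, h3⟩
    refine ⟨fun i => Fin.ext ?_, fun i j hij hji => ?_⟩
    · rw [← extend_coe, ← extend_coe]; exact h1 i
    · have := h3 i j hij
      rw [extend_coe, extend_coe] at this
      exact this hji
  · rintro ⟨h1, h3⟩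
    refine ⟨fun x => ?_, fun x hx => extend_of_le σ (by omega), fun x y hxy hyx => ?_⟩
    · by_cases hx : x < n
      · have := congrArg Fin.val (h1 ⟨x, hx⟩)
        rwa [← extend_coe, ← extend_coe] at this
      · rw [extend_of_le σ (not_lt.1 hx), extend_of_le σ (not_lt.1 hx)]
    · by_cases hx : x < n
      · have hy : y < n := by
          have := (σ ⟨x, hx⟩).2
          rw [← extend_coe] at this
          exact hyx.trans this
        have := h3 ⟨x, hx⟩ ⟨y, hy⟩ hxy
        rw [Fin.lt_def, Fin.lt_def, ← extend_coe, ← extend_coe] at this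
        exact this hyx
      · rw [extend_of_le σ (not_lt.1 hx)] at hyx
        exact absurd hxy hyx.asymm

theorem extend_injective {n : ℕ} : Function.Injective (extend (n := n)) := by
  intro σ τ h
  ext i
  rw [← extend_coe, ← extend_coe, h]

theorem exists_extend_eq {n : ℕ} {f : ℕ → ℕ} (hf : f ∈ intervalInvolutions 0 n) :
    ∃ σ : Perm (Fin n), extend σ = f := by
  have hlt : ∀ i : Fin n, f i < n := by
    intro i
    by_cases h : f i = i
    · rw [h]; exact i.2
    · have := apply_lt_of_mem_intervalInvolutions hf h; omega
  let g : Fin n → Fin n := fun i => ⟨f i, hlt i⟩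
  have hg : Function.Involutive g := fun i => Fin.ext (hf.1 i)
  refine ⟨hg.toPerm, funext fun x => ?_⟩
  by_cases hx : x < n
  · simp [extend, hx, g]
  · rw [extend_of_le _ (not_lt.1 hx), hf.2.1 x (by omega)]

theorem mem_shallowInvolutions {n : ℕ} {σ : Perm (Fin n)} :
    σ ∈ shallowInvolutions n ↔ Function.Involutive σ ∧ PermNoncrossing σ :=
  and_congr_right fun h => isShallow_iff_permNoncrossing h

theorem ncard_shallowInvolutions (n : ℕ) : (shallowInvolutions n).ncard = motzkin n := by
  have hb : Set.BijOn extend (shallowInvolutions n) (intervalInvolutions 0 n) := by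
    refine ⟨fun σ hσ => extend_mem_iff.2 (mem_shallowInvolutions.1 hσ),
      extend_injective.injOn, fun f hf => ?_⟩
    obtain ⟨σ, rfl⟩ := exists_extend_eq hf
    exact ⟨σ, mem_shallowInvolutions.2 (extend_mem_iff.1 hf), rfl⟩
  rw [hb.ncard_eq, ← Nat.card_coe_set_eq]
  exact (finite_and_card_intervalInvolutions n 0).2

/-! ### Chord diagrams -/

theorem mem_chords_of_involutive {n : ℕ} {σ : Perm (Fin n)} (hσ : Function.Involutive σ)
    {i j : Fin n} : s(i, j) ∈ chords σ ↔ i ≠ j ∧ σ i = j := by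
  constructor
  · rintro ⟨k, l, hkl, hc, he⟩
    rcases (sameCycle_iff_of_involutive hσ).1 hc with rfl | rfl
    · exact absurd rfl hkl
    · rcases Sym2.eq_iff.1 he with ⟨rfl, rfl⟩ | ⟨rfl, rfl⟩
      · exact ⟨hkl, rfl⟩
      · exact ⟨hkl.symm, hσ _⟩
  · rintro ⟨hij, rfl⟩
    exact ⟨i, σ i, hij, (sameCycle_iff_of_involutive hσ).2 (Or.inr rfl), rfl⟩

theorem isChordDiagram_chords {n : ℕ} {σ : Perm (Fin n)} (hσ : Function.Involutive σ) :
    IsChordDiagram (chords σ) := by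
  refine ⟨fun e he => ?_, fun e he e' he' v hv hv' => ?_⟩
  · obtain ⟨i, j, hij, -, rfl⟩ := he
    exact hij
  · obtain ⟨w, rfl⟩ := hv
    obtain ⟨w', rfl⟩ := hv'
    rw [← ((mem_chords_of_involutive hσ).1 he).2, ((mem_chords_of_involutive hσ).1 he').2]

theorem isNoncrossing_chords_iff {n : ℕ} {σ : Perm (Fin n)} (hσ : Function.Involutive σ) :
    IsNoncrossing (chords σ) ↔ PermNoncrossing σ := by
  constructor
  · intro h i j hij hji hlt
    exact h i j (σ i) (σ j) hij hji hlt
      ⟨(mem_chords_of_involutive hσ).2 ⟨(hij.trans hji).ne, rfl⟩,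
        (mem_chords_of_involutive hσ).2 ⟨(hji.trans hlt).ne, rfl⟩⟩
  · rintro h a b c d hab hbc hcd ⟨hac, hbd⟩
    obtain ⟨-, rfl⟩ := (mem_chords_of_involutive hσ).1 hac
    obtain ⟨-, rfl⟩ := (mem_chords_of_involutive hσ).1 hbd
    exact h a b hab hbc hcd

/-- The chord at a moved point determines its image; using this in both directions, the fixed points
agree as well. -/
theorem chords_injOn {n : ℕ} : Set.InjOn chords {σ : Perm (Fin n) | Function.Involutive σ} := by
  intro σ hσ τ hτ h
  have key : ∀ {σ τ : Perm (Fin n)}, Function.Involutive σ → Function.Involutive τ →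
      chords σ = chords τ → ∀ i, σ i ≠ i → τ i = σ i := by
    intro σ τ hσ hτ h i hi
    have : s(i, σ i) ∈ chords σ := (mem_chords_of_involutive hσ).2 ⟨hi.symm, rfl⟩
    rw [h] at this
    exact ((mem_chords_of_involutive hτ).1 this).2
  refine Equiv.ext fun i => ?_
  by_cases h1 : σ i = i
  · by_cases h2 : τ i = i
    · rw [h1, h2]
    · exact key hτ hσ h.symm i h2
  · exact (key hσ hτ h i h1).symm

theorem exists_involutive_chords_eq {n : ℕ} {D : Set (Sym2 (Fin n))} (hD : IsChordDiagram D) :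
    ∃ σ : Perm (Fin n), Function.Involutive σ ∧ chords σ = D := by
  classical
  have huniq : ∀ {i j k : Fin n}, s(i, j) ∈ D → s(i, k) ∈ D → j = k := fun {i j k} hj hk =>
    Sym2.congr_right.1 (hD.2 _ hj _ hk i (Sym2.mem_mk_left i j) (Sym2.mem_mk_left i k))
  -- Send each point to its partner, and a point on no chord to itself; disjointness of chords makes
  -- the partner unique.
  let g : Fin n → Fin n := fun i => if h : ∃ j, s(i, j) ∈ D then h.choose else i
  have hg : ∀ {i j}, s(i, j) ∈ D → g i = j := by
    intro i j h
    have hex : ∃ j, s(i, j) ∈ D := ⟨j, h⟩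
    simp only [g, dif_pos hex]
    exact huniq hex.choose_spec h
  have hg' : ∀ i, g i = i ∨ s(i, g i) ∈ D := by
    intro i
    by_cases h : ∃ j, s(i, j) ∈ D
    · obtain ⟨j, h⟩ := h
      exact Or.inr (by rwa [hg h])
    · exact Or.inl (by simp only [g, dif_neg h])
  have hinv : Function.Involutive g := by
    intro i
    rcases hg' i with h | h
    · rw [h, h]
    · exact hg (by rwa [Sym2.eq_swap])
  refine ⟨hinv.toPerm, hinv, Set.ext fun e => ?_⟩
  induction e using Sym2.ind with
  | _ i j =>
    rw [mem_chords_of_involutive (σ := hinv.toPerm) hinv]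
    constructor
    · rintro ⟨hij, rfl⟩
      exact (hg' i).resolve_left hij.symm
    · intro h
      exact ⟨fun hij => hD.1 _ h hij, hg h⟩

theorem bijOn_chords (n : ℕ) :
    Set.BijOn chords (shallowInvolutions n) (noncrossingChordDiagrams n) := by
  refine ⟨fun σ hσ => ?_, chords_injOn.mono fun σ hσ => hσ.1, fun D hD => ?_⟩
  · have h := mem_shallowInvolutions.1 hσ
    exact ⟨isChordDiagram_chords h.1, (isNoncrossing_chords_iff h.1).2 h.2⟩
  · obtain ⟨σ, hσ, rfl⟩ := exists_involutive_chords_eq hD.1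
    exact ⟨σ, mem_shallowInvolutions.2 ⟨hσ, (isNoncrossing_chords_iff hσ).1 hD.2⟩, rfl⟩

end ShallowPerm

theorem mainTheorem5 (n : ℕ) :
    (∀ σ : Equiv.Perm (Fin n), Function.Involutive σ →
      (ShallowPerm.IsShallow σ ↔
        ShallowPerm.Avoids (ShallowPerm.fundamental σ) ShallowPerm.pattern3142)) ∧
    Set.BijOn ShallowPerm.chords (ShallowPerm.shallowInvolutions n)
      (ShallowPerm.noncrossingChordDiagrams n) ∧
    (ShallowPerm.shallowInvolutions n).ncard = ShallowPerm.motzkin n ∧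
    (ShallowPerm.noncrossingChordDiagrams n).ncard = ShallowPerm.motzkin n := by
  refine ⟨fun σ hσ => ?_, ShallowPerm.bijOn_chords n, ShallowPerm.ncard_shallowInvolutions n, ?_⟩
  · rw [ShallowPerm.isShallow_iff_permNoncrossing hσ, ShallowPerm.Avoids,
      ShallowPerm.contains_fundamental_iff hσ, ShallowPerm.PermNoncrossing]
    push Not
    rfl
  · rw [← (ShallowPerm.bijOn_chords n).ncard_eq]
    exact ShallowPerm.ncard_shallowInvolutions n
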